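/- **Setting.** Let $D\ge 1$ and let $\mu$ be a complex Borel measure on the unit torus $\mathbb T^D$. For $\alpha\in\mathbb Z^D$ put $|\alpha|=\sum_a|\alpha_a|$ (the longitude), $z^\alpha=\prod_a z_a^{\alpha_a}$ and $c_\alpha=(2\pi)^{-D}\int_{\mathbb T^D}e^{-i\alpha\cdot\theta}\,d\mu(\theta)$. Let $\hat\mu(z)=\sum_\alpha c_\alpha z^\alpha$ and $\bar{\hat\mu}(z)=\sum_\alpha\overline{c_\alpha}\,z^\alpha$, and let $\mathcal D_\mu\subset(\mathbb C^*)^D$ be the Reinhardt domain of convergence of $\hat\mu(z)$, i.e. the interior of the set of points of $(\mathbb C^*)^D$ at which the series converges absolutely. Semi-infinite matrices are indexed by $\mathbb Z^D$, ordered by increasing longitude (and lexicographically for equal longitude), and are partitioned into blocks according to the longitude. Let $\chi(z)=(z^\alpha)_{\alpha\in\mathbb Z^D}$, let $G=(G_{\alpha,\beta})$, $G_{\alpha,\beta}=\int_{\mathbb T^D}e^{i(\alpha-\beta)\cdot\theta}\,d\mu(\theta)$, be the moment matrix, and let $\Upsilon_\alpha$ be the matrix with entries $(\Upsilon_\alpha)_{\beta,\gamma}=\delta_{\beta+\alpha,\gamma}$.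 A *time* is a family $t=(t_\alpha)_{\alpha\in\mathbb Z^D}$ of complex numbers such that $t(z)=\sum_\alpha t_\alpha z^\alpha$ converges absolutely for all $z\in\mathbb T^D\cup\mathcal D_\mu$; write $\bar t(z)=\sum_\alpha\overline{t_\alpha}z^\alpha$. Put $W_0(t)=\exp\big(\sum_\alpha t_\alpha\Upsilon_\alpha\big)$ and $G(t)=W_0(t)G$. The time $t$ is *admissible* if $G(t)$ has a block Gauss–Borel factorization $$G(t)=S(t)^{-1}H(t)\big(\hat S(t)^{-1}\big)^\dagger$$ with $S(t),\hat S(t)$ block lower triangular with identity diagonal blocks and $H(t)$ block diagonal with nonsingular blocks. For an admissible time put $\Phi(z,t)=S(t)\chi(z)$, $\hat\Phi(z,t)=\hat S(t)\chi(z)$ (the orthogonal Laurent polynomials, MVOLPUT), $$W_1=S(t)W_0(t),\quad \hat W_1^\dagger=W_0(t)\hat S(t)^\dagger,\quad W_2^\dagger=S(t)^{-1}H(t),\quad \hat W_2=H(t)\big(\hat S(t)^{-1}\big)^\dagger,$$ with the inverses $W_1^{-1}=W_0(-t)S(t)^{-1}$, $(\hat W_1^{-1})^\dagger=(\hat S(t)^{-1})^\dagger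 W_0(-t)$, $(W_2^{-1})^\dagger=H(t)^{-1}S(t)$, $\hat W_2^{-1}=\hat S(t)^\dagger H(t)^{-1}$, and define the Baker and adjoint Baker functions, for $j=1,2$, $$\Psi_j=W_j\chi,\qquad \Psi_j^*=(W_j^{-1})^\dagger\chi,\qquad \hat\Psi_j=\hat W_j\chi,\qquad \hat\Psi_j^*=(\hat W_j^{-1})^\dagger\chi .$$ **Theorem (Bilinear equations).** Let $\boldsymbol c,\hat{\boldsymbol c}\in\mathcal D_\mu$, let $r=(|c_a|)_a$ and $\hat r=(|\hat c_a|)_a$ be their poly-radii and $\hat r^{-1}=(|\hat c_a|^{-1})_a$, let $\mathbb T^D(r)=\{|z_a|=r_a\}$ (each circle positively oriented), and let $t,t'$ be admissible times. The series defining $\Psi_1,\hat\Psi_1^*,\hat\Psi_2$ converge absolutely at $z$ and those defining $\Psi_1^*,\hat\Psi_1,\Psi_2$ at $z^{-1}$ for every $z\in\mathcal D_\mu$, those defining $\Psi_2^*,\hat\Psi_2^*$ converge for every $z\in(\mathbb C^*)^D$; all the (entrywise) integrals below exist; and, with $d^Dz=dz_1\cdots dz_D$, $$\oint_{\mathbb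 T^D(r)}\frac{\Psi_1(z,t)\,\Psi_1^*(\bar z^{-1},t')^\dagger}{\prod_a z_a}d^Dz=\oint_{\mathbb T^D(\hat r^{-1})}\frac{\hat\Psi_2(z^{-1},t)\,\hat\Psi_2^*(\bar z,t')^\dagger}{\prod_a z_a}d^Dz,$$ $$\oint_{\mathbb T^D(r)}\frac{\Psi_2(z^{-1},t)\,\Psi_2^*(\bar z,t')^\dagger}{\prod_a z_a}d^Dz=\oint_{\mathbb T^D(\hat r^{-1})}\frac{\hat\Psi_1(z,t)\,\hat\Psi_1^*(\bar z^{-1},t')^\dagger}{\prod_a z_a}d^Dz,$$ $$\oint_{\mathbb T^D(r)}\frac{\Psi_1(z,t)\,\Psi_2(\bar z^{-1},t')^\dagger}{\prod_a z_a}d^Dz=\oint_{\mathbb T^D(\hat r^{-1})}\frac{\hat\Psi_2(z^{-1},t)\,\hat\Psi_1(\bar z,t')^\dagger}{\prod_a z_a}d^Dz,$$ $$\oint_{\mathbb T^D(r)}\frac{\Psi_2^*(z,t)\,\Psi_1^*(\bar z^{-1},t')^\dagger}{\prod_a z_a}d^Dz=\oint_{\mathbb T^D(\hat r^{-1})}\frac{\hat\Psi_1^*(z^{-1},t)\,\hat\Psi_2^*(\bar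 z,t')^\dagger}{\prod_a z_a}d^Dz.$$ Moreover, the MVOLPUT satisfy $$\oint_{\mathbb T^D(r)}\Phi(z,t)\hat\Phi(\bar z^{-1},t')^\dagger\frac{e^{t(z)}\hat\mu(z)}{\prod_a z_a}d^Dz=\oint_{\mathbb T^D(\hat r^{-1})}\Phi(z^{-1},t)\hat\Phi(\bar z,t')^\dagger\frac{e^{t(z^{-1})}\hat\mu(z^{-1})}{\prod_a z_a}d^Dz,$$ $$\oint_{\mathbb T^D(r)}\hat\Phi(z^{-1},t)\Phi(\bar z,t')^\dagger\frac{e^{\bar t(z)}\bar{\hat\mu}(z)}{\prod_a z_a}d^Dz=\oint_{\mathbb T^D(\hat r^{-1})}\hat\Phi(z,t)\Phi(\bar z^{-1},t')^\dagger\frac{e^{\bar t(z^{-1})}\bar{\hat\mu}(z^{-1})}{\prod_a z_a}d^Dz,$$ $$\oint_{\mathbb T^D(r)}\Phi(z,t)\hat\Phi(\bar z^{-1},t')^\dagger\frac{e^{(t+t')(z)}\hat\mu(z)}{\prod_a z_a}d^Dz=\oint_{\mathbb T^D(\hat r^{-1})}\Phi(z^{-1},t)\hat\Phi(\bar z,t')^\dagger\frac{e^{(t+t')(z^{-1})}\hat\mu(z^{-1})}{\prod_a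 z_a}d^Dz,$$ $$\oint_{\mathbb T^D(r)}\Phi(z,t)\hat\Phi(\bar z^{-1},t')^\dagger\frac{\hat\mu(z)}{\prod_a z_a}d^Dz=\oint_{\mathbb T^D(\hat r^{-1})}\Phi(z^{-1},t)\hat\Phi(\bar z,t')^\dagger\frac{\hat\mu(z^{-1})}{\prod_a z_a}d^Dz.$$ -/

import Mathlib

open MeasureTheory
open scoped Matrix

namespace TorusLaurent

noncomputable section

/-! ### Laurent monomials and semi-infinite matrices

The semi-infinite matrices have their rows and columns labelled by the multi-indices in `ℤ^D`
themselves; the blocks are cut out by the longitude. -/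

/-- Multi-indices in `ℤ^D`. -/
abbrev Idx (D : ℕ) := Fin D → ℤ

/-- Semi-infinite complex matrices, with entries labelled by pairs of multi-indices. -/
abbrev IMat (D : ℕ) := Matrix (Idx D) (Idx D) ℂ

/-- The longitude `|α| = ∑ |α_a|` of a multi-index. -/
def longitude {D : ℕ} (α : Idx D) : ℕ := ∑ a, (α a).natAbs

/-- The vector `χ(z)` of all Laurent monomials `z^α`. -/
def chi {D : ℕ} (z : Fin D → ℂ) : Idx D → ℂ := fun α => ∏ a, z a ^ α a

/-- Product of semi-infinite matrices. -/
def mulMat {D : ℕ} (A B : IMat D) : IMat D := fun α β => ∑' γ, A α γ * B γ β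

infixl:70 " ⊠ " => TorusLaurent.mulMat

/-- Action of a semi-infinite matrix on a semi-infinite vector. -/
def act {D : ℕ} (A : IMat D) (v : Idx D → ℂ) : Idx D → ℂ := fun α => ∑' β, A α β * v β

/-- The series which define the vector `A χ(z)` converge absolutely. -/
def ActConverges {D : ℕ} (A : IMat D) (z : Fin D → ℂ) : Prop :=
  ∀ α, Summable fun β => ‖A α β * chi z β‖

/-- Powers of a semi-infinite matrix. -/
def powMat {D : ℕ} (A : IMat D) : ℕ → IMat D
  | 0 => 1
  | n + 1 => powMat A n ⊠ A

/-- Exponential of a semi-infinite matrix. -/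
def expMat {D : ℕ} (A : IMat D) : IMat D := fun α β => ∑' n : ℕ, (n.factorial : ℂ)⁻¹ * powMat A n α β

/-- The Laurent series `∑ L_α z^α`. -/
def laurent {D : ℕ} (L : Idx D → ℂ) (z : Fin D → ℂ) : ℂ := ∑' α, L α * chi z α

/-! ### The measure, its Laurent series and its moment matrix -/

/-- The unit circle carries its Borel sets (and the unit torus the product of them). -/
instance circleMeasurableSpace : MeasurableSpace Circle := borel Circle

instance circleBorelSpace : BorelSpace Circle := ⟨rfl⟩

/-- The integral of a complex function on the unit torus against a complex Borel measure. -/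
def torusMeasureIntegral {D : ℕ} (μ : ComplexMeasure (Fin D → Circle))
    (f : (Fin D → Circle) → ℂ) : ℂ :=
  μ.integral f (ContinuousLinearMap.mul ℝ ℂ)

/-- The Fourier coefficients `c_α = (2π)^{-D} ∫ e^{-i α·θ} dμ(θ)`. -/
def momentCoeff {D : ℕ} (μ : ComplexMeasure (Fin D → Circle)) (α : Idx D) : ℂ :=
  (((2 * Real.pi) ^ D : ℝ) : ℂ)⁻¹ *
    torusMeasureIntegral μ (fun ζ => ∏ a, (ζ a : ℂ) ^ (-(α a)))

/-- The moment matrix `G_{α,β} = ∫ e^{i (α-β)·θ} dμ(θ)`. -/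
def momentMatrix {D : ℕ} (μ : ComplexMeasure (Fin D → Circle)) : IMat D :=
  fun α β => torusMeasureIntegral μ (fun ζ => ∏ a, (ζ a : ℂ) ^ (α a - β a))

/-- The Reinhardt domain of convergence of the Laurent series `∑ c_α z^α` of the measure: the
interior of the set of points of the algebraic torus where the series converges absolutely. -/
def reinhardtDomain {D : ℕ} (μ : ComplexMeasure (Fin D → Circle)) : Set (Fin D → ℂ) :=
  interior {z | (∀ a, z a ≠ 0) ∧ Summable fun α => ‖momentCoeff μ α * chi z α‖}

/-! ### Continuous deformations -/

/-- The matrix `Υ_α = ∏_a Υ_a^{α_a}`, with entries `δ_{β+α,γ}`; for `α = e_a` it is the spectral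
matrix `Υ_a`. -/
def upsilon {D : ℕ} (α : Idx D) : IMat D := fun β γ => if β + α = γ then 1 else 0

theorem upsilon_zero {D : ℕ} : upsilon (0 : Idx D) = 1 := by
  ext β γ
  simp [upsilon, Matrix.one_apply]

theorem upsilon_add {D : ℕ} (α α' : Idx D) : upsilon (α + α') = upsilon α ⊠ upsilon α' := by
  ext β γ
  unfold mulMat
  rw [tsum_eq_single (β + α)]
  · simp [upsilon, add_assoc]
  · intro δ hδ
    simp [upsilon, hδ.symm]

/-- The matrix `t(Υ) = ∑_α t_α Υ_α`. -/
def timeMatrix {D : ℕ} (t : Idx D → ℂ) : IMat D := fun β γ => ∑' α, t α * upsilon α β γ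

/-- The vacuum wave matrix `W₀(t) = exp(∑_α t_α Υ_α)`; its inverse is `W₀(-t)`. -/
def vacuum {D : ℕ} (t : Idx D → ℂ) : IMat D := expMat (timeMatrix t)

/-- The deformed moment matrix `G(t) = W₀(t) G`. -/
def deformedMoment {D : ℕ} (μ : ComplexMeasure (Fin D → Circle)) (t : Idx D → ℂ) : IMat D :=
  vacuum t ⊠ momentMatrix μ

/-- The Laurent series `t(z) = ∑ t_α z^α` converges absolutely on the unit torus and on the
Reinhardt domain of the measure. -/
structure ConvergentTime {D : ℕ} (μ : ComplexMeasure (Fin D → Circle)) (t : Idx D → ℂ) :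
    Prop where
  unitTorus : Summable fun α => ‖t α‖
  domain : ∀ z ∈ reinhardtDomain μ, Summable fun α => ‖t α * chi z α‖

/-! ### Block Gauss--Borel factorization -/

/-- Block lower triangular matrices with identity matrices as diagonal blocks. -/
def BlockUnitriangular {D : ℕ} (A : IMat D) : Prop :=
  (∀ α β, longitude α < longitude β → A α β = 0) ∧
    ∀ α β, longitude α = longitude β → A α β = (1 : IMat D) α β

/-- Block diagonal matrices. -/
def BlockDiagonal {D : ℕ} (A : IMat D) : Prop :=
  ∀ α β, longitude α ≠ longitude β → A α β = 0

/-- A block Gauss--Borel factorization `G = S⁻¹ H (Ŝ⁻¹)†`, with `S`, `Ŝ` block lower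
unitriangular and `H` block diagonal with nonsingular blocks, together with the (unique) inverses
of the three factors. -/
structure GaussBorel {D : ℕ} (G : IMat D) where
  S : IMat D
  SInv : IMat D
  H : IMat D
  HInv : IMat D
  SHat : IMat D
  SHatInv : IMat D
  S_tri : BlockUnitriangular S
  SInv_tri : BlockUnitriangular SInv
  S_mul_SInv : S ⊠ SInv = 1
  SInv_mul_S : SInv ⊠ S = 1
  SHat_tri : BlockUnitriangular SHat
  SHatInv_tri : BlockUnitriangular SHatInv
  SHat_mul_SHatInv : SHat ⊠ SHatInv = 1
  SHatInv_mul_SHat : SHatInv ⊠ SHat = 1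
  H_diag : BlockDiagonal H
  HInv_diag : BlockDiagonal HInv
  H_mul_HInv : H ⊠ HInv = 1
  HInv_mul_H : HInv ⊠ H = 1
  factorization : G = SInv ⊠ H ⊠ SHatInvᴴ

namespace GaussBorel

variable {D : ℕ} {μ : ComplexMeasure (Fin D → Circle)} {t : Idx D → ℂ}

/-- The orthogonal Laurent polynomials `Φ(z,t) = S(t) χ(z)`. -/
def Phi (F : GaussBorel (deformedMoment μ t)) (z : Fin D → ℂ) : Idx D → ℂ := act F.S (chi z)

/-- The orthogonal Laurent polynomials `Φ̂(z,t) = Ŝ(t) χ(z)`. -/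
def PhiHat (F : GaussBorel (deformedMoment μ t)) (z : Fin D → ℂ) : Idx D → ℂ :=
  act F.SHat (chi z)

/-! The wave matrices and their inverses. -/

/-- `W₁ = S(t) W₀(t)`. -/
def W1 (F : GaussBorel (deformedMoment μ t)) : IMat D := F.S ⊠ vacuum t

/-- `W₁⁻¹ = W₀(t)⁻¹ S(t)⁻¹`. -/
def W1Inv (F : GaussBorel (deformedMoment μ t)) : IMat D := vacuum (-t) ⊠ F.SInv

/-- `Ŵ₁` is given by `Ŵ₁† = W₀(t) Ŝ(t)†`. -/
def W1Hat (F : GaussBorel (deformedMoment μ t)) : IMat D := (vacuum t ⊠ F.SHatᴴ)ᴴ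

/-- `Ŵ₁⁻¹` is given by `(Ŵ₁⁻¹)† = (Ŵ₁†)⁻¹ = (Ŝ(t)⁻¹)† W₀(t)⁻¹`. -/
def W1HatInv (F : GaussBorel (deformedMoment μ t)) : IMat D := (F.SHatInvᴴ ⊠ vacuum (-t))ᴴ

/-- `W₂` is given by `W₂† = S(t)⁻¹ H(t)`. -/
def W2 (F : GaussBorel (deformedMoment μ t)) : IMat D := (F.SInv ⊠ F.H)ᴴ

/-- `W₂⁻¹` is given by `(W₂⁻¹)† = (W₂†)⁻¹ = H(t)⁻¹ S(t)`. -/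
def W2Inv (F : GaussBorel (deformedMoment μ t)) : IMat D := (F.HInv ⊠ F.S)ᴴ

/-- `Ŵ₂ = H(t) (Ŝ(t)⁻¹)†`. -/
def W2Hat (F : GaussBorel (deformedMoment μ t)) : IMat D := F.H ⊠ F.SHatInvᴴ

/-- `Ŵ₂⁻¹ = Ŝ(t)† H(t)⁻¹`. -/
def W2HatInv (F : GaussBorel (deformedMoment μ t)) : IMat D := F.SHatᴴ ⊠ F.HInv

/-! The Baker and adjoint Baker functions. -/

/-- `Ψ₁ = W₁ χ`. -/
def Psi1 (F : GaussBorel (deformedMoment μ t)) (z : Fin D → ℂ) : Idx D → ℂ := act F.W1 (chi z)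

/-- `Ψ₁* = (W₁⁻¹)† χ`. -/
def Psi1Adj (F : GaussBorel (deformedMoment μ t)) (z : Fin D → ℂ) : Idx D → ℂ :=
  act F.W1Invᴴ (chi z)

/-- `Ψ̂₁ = Ŵ₁ χ`. -/
def Psi1Hat (F : GaussBorel (deformedMoment μ t)) (z : Fin D → ℂ) : Idx D → ℂ :=
  act F.W1Hat (chi z)

/-- `Ψ̂₁* = (Ŵ₁⁻¹)† χ`. -/
def Psi1HatAdj (F : GaussBorel (deformedMoment μ t)) (z : Fin D → ℂ) : Idx D → ℂ :=
  act F.W1HatInvᴴ (chi z)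

/-- `Ψ₂ = W₂ χ`. -/
def Psi2 (F : GaussBorel (deformedMoment μ t)) (z : Fin D → ℂ) : Idx D → ℂ := act F.W2 (chi z)

/-- `Ψ₂* = (W₂⁻¹)† χ`. -/
def Psi2Adj (F : GaussBorel (deformedMoment μ t)) (z : Fin D → ℂ) : Idx D → ℂ :=
  act F.W2Invᴴ (chi z)

/-- `Ψ̂₂ = Ŵ₂ χ`. -/
def Psi2Hat (F : GaussBorel (deformedMoment μ t)) (z : Fin D → ℂ) : Idx D → ℂ :=
  act F.W2Hat (chi z)

/-- `Ψ̂₂* = (Ŵ₂⁻¹)† χ`. -/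
def Psi2HatAdj (F : GaussBorel (deformedMoment μ t)) (z : Fin D → ℂ) : Idx D → ℂ :=
  act F.W2HatInvᴴ (chi z)

/-- The series defining the Baker functions converge absolutely at the points where these
functions are considered. -/
def BakerConverges (F : GaussBorel (deformedMoment μ t)) : Prop :=
  (∀ z ∈ reinhardtDomain μ,
    ActConverges F.W1 z ∧ ActConverges F.W1Invᴴ z⁻¹ ∧
    ActConverges F.W1Hat z⁻¹ ∧ ActConverges F.W1HatInvᴴ z ∧
    ActConverges F.W2Hat z ∧ ActConverges F.W2 z⁻¹) ∧
  ∀ z, ActConverges F.W2HatInvᴴ z ∧ ActConverges F.W2Invᴴ z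

end GaussBorel

/-! ### Contour integrals -/

/-- The matrix `u v†`. -/
def outer {D : ℕ} (u v : Idx D → ℂ) : IMat D := Matrix.vecMulVec u (star v)

/-- The entries of `F(z) / ∏ z_a` are integrable over the torus `𝕋^D(r)`. -/
def ContourIntegrable {D : ℕ} (r : Fin D → ℝ) (F : (Fin D → ℂ) → IMat D) : Prop :=
  ∀ α β, TorusIntegrable (fun z => F z α β / ∏ a, z a) 0 r

/-- The entrywise contour integral of `F(z) / ∏ z_a` over the torus `𝕋^D(r)`. -/
def contourIntegral {D : ℕ} (r : Fin D → ℝ) (F : (Fin D → ℂ) → IMat D) : IMat D :=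
  fun α β => torusIntegral (fun z => F z α β / ∏ a, z a) 0 r

/-- Both contour integrals exist, and they agree. -/
def ContourEq {D : ℕ} (r : Fin D → ℝ) (F : (Fin D → ℂ) → IMat D)
    (r' : Fin D → ℝ) (F' : (Fin D → ℂ) → IMat D) : Prop :=
  ContourIntegrable r F ∧ ContourIntegrable r' F' ∧ contourIntegral r F = contourIntegral r' F'

end

end TorusLaurent

open TorusLaurent

/-! Each equation compares two integrals of one function. If f is the sum of a single absolutely
convergent Laurent series on the two tori |z_a| = |c_a| and |z_a| = |c'_a|, then integrating f(z)/∏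
z_a over the first gives (2πi)^D times the constant coefficient (`torusIntegral_laurent`).
Integrating f(z⁻¹)/∏ z_a over |z_a| = |c'_a|⁻¹ gives the same number, since z ↦ z⁻¹ reflects the
coefficients and fixes the one at 0. This is `contourEq_of_laurentOn`; it remains to show that every
pair of integrands has the form f(z), f(z⁻¹).

For this the Baker functions are put in closed form. The matrices W₀(t), G and G(t) are constant
along diagonals, and χ(z) is an eigenvector of such a matrix with its Laurent symbol as eigenvalue
(`act_toeplitz`); the symbols are e^{t(z)}, (2π)^D μ̂(z) and their product. The inverses S⁻¹ and
(Ŝ⁻¹)† are eliminated through the factorization: S⁻¹ = G(t) Ŝ† H⁻¹ and (Ŝ⁻¹)† = H⁻¹ S G(t). Each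
wave matrix then becomes a diagonal-constant matrix times one with finite rows or finite columns,
and in W₁⁻¹ and (Ŵ₁⁻¹)† the factor W₀(-t) cancels against W₀(t). Hence each Baker function, taken at
z or z⁻¹ as appropriate, is a Laurent polynomial times a scalar built from e^t and μ̂, possibly
conjugated, and the two integrands differ only in which factor carries the symbol of the measure. -/

namespace TorusLaurent

/-! ### Absolutely convergent Laurent series -/

section Laurent

variable {D : ℕ}

theorem chi_zero (z : Fin D → ℂ) : chi z 0 = 1 := by
  simp [chi]

theorem chi_add {z : Fin D → ℂ} (hz : ∀ a, z a ≠ 0) (α β : Idx D) :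
    chi z (α + β) = chi z α * chi z β := by
  simp [chi, zpow_add₀ (hz _), Finset.prod_mul_distrib]

theorem chi_inv (z : Fin D → ℂ) (α : Idx D) : chi z⁻¹ α = chi z (-α) := by
  simp [chi]

theorem chi_star (z : Fin D → ℂ) (α : Idx D) : chi (star z) α = star (chi z α) := by
  simp [chi]

theorem norm_chi (z : Fin D → ℂ) (α : Idx D) : ‖chi z α‖ = ∏ a, ‖z a‖ ^ α a := by
  simp [chi, norm_prod]

theorem chi_ne_zero {z : Fin D → ℂ} (hz : ∀ a, z a ≠ 0) (α : Idx D) : chi z α ≠ 0 :=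
  Finset.prod_ne_zero_iff.2 fun a _ => zpow_ne_zero _ (hz a)

/-- The Laurent series `∑ a_α z^α` converges absolutely at `z`. -/
def AbsConv (a : Idx D → ℂ) (z : Fin D → ℂ) : Prop :=
  Summable fun α => ‖a α * chi z α‖

/-- Absolute convergence depends only on the moduli of the coordinates, so convergence at one point
gives convergence on the whole torus through it. -/
theorem AbsConv.congr_norm {a : Idx D → ℂ} {z w : Fin D → ℂ} (h : AbsConv a z)
    (hzw : ∀ i, ‖w i‖ = ‖z i‖) : AbsConv a w := by
  unfold AbsConv at h ⊢
  simpa only [norm_mul, norm_chi, hzw] using h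

theorem AbsConv.of_finite_support {a : Idx D → ℂ} (h : a.support.Finite) (z : Fin D → ℂ) :
    AbsConv a z := by
  refine summable_of_hasFiniteSupport (h.subset fun α hα => ?_)
  contrapose! hα
  simp [Function.notMem_support.1 hα]

theorem AbsConv.const_mul {a : Idx D → ℂ} {z : Fin D → ℂ} (h : AbsConv a z) (k : ℂ) :
    AbsConv (fun α => k * a α) z := by
  simpa only [AbsConv, mul_assoc, norm_mul] using Summable.mul_left ‖k‖ h

theorem laurent_const_mul (a : Idx D → ℂ) (z : Fin D → ℂ) (k : ℂ) :
    laurent (fun α => k * a α) z = k * laurent a z := by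
  simp only [laurent, mul_assoc, tsum_mul_left]

theorem AbsConv.neg {a : Idx D → ℂ} {z : Fin D → ℂ} (h : AbsConv a z) : AbsConv (-a) z := by
  simpa [AbsConv] using h

theorem laurent_neg (a : Idx D → ℂ) (z : Fin D → ℂ) : laurent (-a) z = -laurent a z := by
  simp [laurent, tsum_neg]

theorem AbsConv.add {a b : Idx D → ℂ} {z : Fin D → ℂ} (ha : AbsConv a z) (hb : AbsConv b z) :
    AbsConv (a + b) z := by
  refine Summable.of_nonneg_of_le (fun _ => norm_nonneg _) (fun α => ?_) (Summable.add ha hb)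
  rw [Pi.add_apply, add_mul]
  exact norm_add_le _ _

theorem absConv_reflect {a : Idx D → ℂ} {z : Fin D → ℂ} (h : AbsConv a z) :
    AbsConv (fun α => a (-α)) z⁻¹ := by
  have := (Equiv.neg (Idx D)).summable_iff.2 h
  simpa [AbsConv, chi_inv, Function.comp_def] using this

theorem laurent_reflect (a : Idx D → ℂ) (z : Fin D → ℂ) :
    laurent (fun α => a (-α)) z⁻¹ = laurent a z := by
  simp only [laurent, chi_inv]
  exact (Equiv.neg (Idx D)).tsum_eq (fun α => a α * chi z α)

theorem AbsConv.star {a : Idx D → ℂ} {z : Fin D → ℂ} (h : AbsConv a z) :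
    AbsConv (star a) z := by
  simpa [AbsConv] using h

theorem laurent_star (a : Idx D → ℂ) (z : Fin D → ℂ) :
    laurent (star a) z = star (laurent a (star z)) := by
  simp only [laurent, chi_star]
  rw [show ∀ x : ℂ, star x = starRingEnd ℂ x from fun _ => rfl, Complex.conj_tsum]
  simp

/-- Convolution of coefficient families. -/
noncomputable def conv (a b : Idx D → ℂ) : Idx D → ℂ := fun k => ∑' j, a j * b (k - j)

/-- The pairs `(j, k - j)` parametrize `ℤ^D × ℤ^D`. -/
def convEquiv (D : ℕ) : Idx D × Idx D ≃ Idx D × Idx D where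
  toFun p := (p.2, p.1 - p.2)
  invFun p := (p.1 + p.2, p.1)
  left_inv p := by simp
  right_inv p := by simp

/-! ### Products of Laurent series as convolutions -/

section
variable {a b : Idx D → ℂ} {z : Fin D → ℂ}

theorem conv_term (hz : ∀ i, z i ≠ 0) (k j : Idx D) :
    (a j * chi z j) * (b (k - j) * chi z (k - j)) = a j * b (k - j) * chi z k := by
  have : chi z k = chi z j * chi z (k - j) := by rw [← chi_add hz, add_sub_cancel]
  rw [this]; ring

theorem summable_norm_conv_terms (hz : ∀ i, z i ≠ 0) (ha : AbsConv a z) (hb : AbsConv b z) :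
    Summable fun p : Idx D × Idx D => ‖a p.2 * b (p.1 - p.2) * chi z p.1‖ := by
  have := (convEquiv D).summable_iff.2 (Summable.mul_norm ha hb)
  refine this.congr fun p => ?_
  simp only [Function.comp_apply, convEquiv, Equiv.coe_fn_mk, conv_term hz]

/-- The monomial z^k is a fixed nonzero factor of all terms of degree k and can be divided out: one
common point of convergence makes every convolution sum converge. -/
theorem summable_norm_conv (hz : ∀ i, z i ≠ 0) (ha : AbsConv a z) (hb : AbsConv b z) (k : Idx D) :
    Summable fun j => ‖a j * b (k - j)‖ := by
  have := (summable_norm_conv_terms hz ha hb).prod_factor k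
  simp only [norm_mul _ (chi z k)] at this
  exact (summable_mul_right_iff (norm_ne_zero_iff.2 (chi_ne_zero hz k))).1 this

theorem AbsConv.conv (hz : ∀ i, z i ≠ 0) (ha : AbsConv a z) (hb : AbsConv b z) :
    AbsConv (conv a b) z := by
  have h := summable_norm_conv_terms hz ha hb
  refine Summable.of_nonneg_of_le (fun _ => norm_nonneg _) (fun k => ?_) h.prod
  rw [TorusLaurent.conv, ← tsum_mul_right]
  exact norm_tsum_le_tsum_norm (h.prod_factor k)

/-- Submultiplicativity of the ℓ¹ norm weighted by |z^α|; it supplies the bound for the exponential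
series. -/
theorem tsum_norm_conv_le (hz : ∀ i, z i ≠ 0) (ha : AbsConv a z) (hb : AbsConv b z) :
    ∑' k, ‖TorusLaurent.conv a b k * chi z k‖ ≤
      (∑' k, ‖a k * chi z k‖) * ∑' k, ‖b k * chi z k‖ := by
  have h := summable_norm_conv_terms hz ha hb
  have e : (∑' k, ‖a k * chi z k‖) * ∑' k, ‖b k * chi z k‖ =
      ∑' p : Idx D × Idx D, ‖a p.2 * b (p.1 - p.2) * chi z p.1‖ := by
    rw [Summable.tsum_mul_tsum ha hb
      (Summable.mul_of_nonneg ha hb (fun _ => norm_nonneg _) fun _ => norm_nonneg _),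
      ← (convEquiv D).tsum_eq]
    refine tsum_congr fun p => ?_
    simp only [convEquiv, Equiv.coe_fn_mk, ← norm_mul, conv_term hz]
  rw [e, h.tsum_prod]
  refine Summable.tsum_le_tsum (fun k => ?_) (AbsConv.conv hz ha hb) h.prod
  rw [TorusLaurent.conv, ← tsum_mul_right]
  exact norm_tsum_le_tsum_norm (h.prod_factor k)

theorem laurent_conv (hz : ∀ i, z i ≠ 0) (ha : AbsConv a z) (hb : AbsConv b z) :
    laurent (conv a b) z = laurent a z * laurent b z := by
  have h := (summable_norm_conv_terms hz ha hb).of_norm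
  rw [laurent, laurent, laurent, tsum_mul_tsum_of_summable_norm ha hb, ← (convEquiv D).tsum_eq]
  simp only [convEquiv, Equiv.coe_fn_mk, conv_term hz]
  rw [h.tsum_prod]
  refine tsum_congr fun k => ?_
  rw [conv, ← tsum_mul_right]

end

/-! ### Contour integrals of Laurent series -/

theorem setIntegral_torus_monomial (α : Idx D) :
    ∫ θ in Set.Icc (0 : Fin D → ℝ) (fun _ => 2 * Real.pi),
      ∏ i, Complex.exp (θ i * Complex.I) ^ α i =
    if α = 0 then (((2 * Real.pi) ^ D : ℝ) : ℂ) else 0 := by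
  have hone (n : ℤ) : ∫ x in Set.Icc (0 : ℝ) (2 * Real.pi), Complex.exp (x * Complex.I) ^ n =
      if n = 0 then ((2 * Real.pi : ℝ) : ℂ) else 0 := by
    rw [integral_Icc_eq_integral_Ioc, ← intervalIntegral.integral_of_le Real.two_pi_pos.le]
    split_ifs with h
    · simp [h]
    · have hn : (n : ℂ) * Complex.I ≠ 0 := mul_ne_zero (Int.cast_ne_zero.2 h) Complex.I_ne_zero
      have e (x : ℝ) : Complex.exp (x * Complex.I) ^ n = Complex.exp (n * Complex.I * x) := by
        rw [← Complex.exp_int_mul]; ring_nf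
      simp only [e]
      rw [integral_exp_mul_complex hn]
      have : Complex.exp (n * Complex.I * (2 * Real.pi : ℝ)) = 1 := by
        rw [← Complex.exp_int_mul_two_pi_mul_I n]; push_cast; ring_nf
      rw [this]; simp
  rw [← Set.pi_univ_Icc, volume_pi, Measure.restrict_pi_pi]
  rw [integral_fintype_prod_eq_prod (fun i (x : ℝ) => Complex.exp (x * Complex.I) ^ α i)]
  simp only [Pi.zero_apply, hone]
  split_ifs with h
  · simp [h]
  · obtain ⟨i, hi⟩ := Function.ne_iff.1 h
    exact Finset.prod_eq_zero (Finset.mem_univ i) (if_neg hi)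

theorem chi_torusMap (r : Fin D → ℝ) (θ : Fin D → ℝ) (α : Idx D) :
    chi (torusMap 0 r θ) α =
      chi (fun i => (r i : ℂ)) α * ∏ i, Complex.exp (θ i * Complex.I) ^ α i := by
  simp [chi, torusMap, mul_zpow, Finset.prod_mul_distrib]

/-- Weierstrass M-test: on a torus each term has constant modulus. -/
theorem continuous_laurent_torusMap {a : Idx D → ℂ} {r : Fin D → ℝ}
    (h : AbsConv a (fun i => (r i : ℂ))) :
    Continuous fun θ => laurent a (torusMap 0 r θ) := by
  simp only [laurent, chi_torusMap]
  refine continuous_tsum (fun α => ?_) h fun α θ => ?_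
  · refine continuous_const.mul (continuous_const.mul (continuous_finsetProd _ fun i _ => ?_))
    exact Continuous.zpow₀ (by fun_prop) _ fun _ => Or.inl (Complex.exp_ne_zero _)
  · simp [norm_prod, Complex.norm_exp_ofReal_mul_I]

theorem torusIntegrable_laurent {a : Idx D → ℂ} {r : Fin D → ℝ} (hr : ∀ i, r i ≠ 0)
    (h : AbsConv a (fun i => (r i : ℂ))) :
    TorusIntegrable (fun z => laurent a z / ∏ i, z i) 0 r := by
  refine ContinuousOn.integrableOn_compact isCompact_Icc (Continuous.continuousOn ?_)
  refine (continuous_laurent_torusMap h).div ?_ fun θ => ?_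
  · simp only [torusMap]; fun_prop
  · simp [torusMap, Finset.prod_eq_zero_iff, hr]

/-- Since dz_a = i z_a dθ_a, the denominator cancels and leaves i^D; integrating term by term kills
every nonconstant frequency. The value no longer involves `r`, which is what allows different tori
to be compared. -/
theorem torusIntegral_laurent {a : Idx D → ℂ} {r : Fin D → ℝ} (hr : ∀ i, r i ≠ 0)
    (h : AbsConv a (fun i => (r i : ℂ))) :
    torusIntegral (fun z => laurent a z / ∏ i, z i) 0 r =
      (2 * Real.pi * Complex.I) ^ D * a 0 := by
  have e (θ : Fin D → ℝ) :
      (∏ i, (r i : ℂ) * Complex.exp (θ i * Complex.I) * Complex.I) •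
        (laurent a (torusMap 0 r θ) / ∏ i, torusMap 0 r θ i) =
      Complex.I ^ D * ∑' α, a α * chi (fun i => (r i : ℂ)) α *
        ∏ i, Complex.exp (θ i * Complex.I) ^ α i := by
    have h0 : ∏ i, torusMap 0 r θ i ≠ 0 := by
      simp [torusMap, Finset.prod_eq_zero_iff, hr]
    have h1 : (∏ i, (r i : ℂ) * Complex.exp (θ i * Complex.I) * Complex.I) =
        (∏ i, torusMap 0 r θ i) * Complex.I ^ D := by
      rw [Finset.prod_mul_distrib]; simp [torusMap]
    rw [h1, smul_eq_mul, mul_right_comm, mul_div_cancel₀ _ h0, mul_comm]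
    simp only [laurent, chi_torusMap, mul_assoc]
  -- The modulus does not depend on θ, so the integrals of the norms are summable and sum and
  -- integral may be exchanged.
  have hn (α : Idx D) (θ : Fin D → ℝ) : ‖a α * chi (fun i => (r i : ℂ)) α *
        ∏ i, Complex.exp (θ i * Complex.I) ^ α i‖ = ‖a α * chi (fun i => (r i : ℂ)) α‖ := by
    simp [norm_prod, Complex.norm_exp_ofReal_mul_I]
  rw [torusIntegral]
  simp only [e]
  rw [integral_const_mul, ← integral_tsum_of_summable_integral_norm]
  · simp only [integral_const_mul, setIntegral_torus_monomial]
    rw [tsum_eq_single 0 fun α hα => by simp [hα]]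
    simp [chi_zero, mul_pow]; ring
  · intro α
    refine ContinuousOn.integrableOn_compact isCompact_Icc (Continuous.continuousOn ?_)
    refine continuous_const.mul (continuous_finsetProd _ fun i _ => ?_)
    exact Continuous.zpow₀ (by fun_prop) _ fun _ => Or.inl (Complex.exp_ne_zero _)
  · simp only [hn, setIntegral_const, smul_eq_mul]
    exact Summable.mul_left _ h

/-- The coefficients of an absolutely convergent Laurent series are determined by its sum. -/
theorem eq_of_laurent_eq {a b : Idx D → ℂ} {z : Fin D → ℂ} (hz : ∀ i, z i ≠ 0)
    (ha : AbsConv a z) (hb : AbsConv b z)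
    (h : ∀ w : Fin D → ℂ, (∀ i, ‖w i‖ = ‖z i‖) → laurent a w = laurent b w) : a = b := by
  -- The coefficient at `k` is the constant coefficient of the series divided by z^k, so the
  -- integral formula will be applied to translated families.
  have shift {a : Idx D → ℂ} (k : Idx D) {w : Fin D → ℂ} (hw : ∀ i, w i ≠ 0)
      (α : Idx D) : a (α + k) * chi w α = (chi w k)⁻¹ * (a (α + k) * chi w (α + k)) := by
    rw [chi_add hw]; field_simp [chi_ne_zero hw k]
  have habs {a : Idx D → ℂ} (k : Idx D) {w : Fin D → ℂ} (hw : ∀ i, w i ≠ 0) (h : AbsConv a w) :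
      AbsConv (fun α => a (α + k)) w := by
    have := (Equiv.addRight k).summable_iff (f := fun α => ‖a α * chi w α‖) |>.2 h
    refine (this.mul_left ‖(chi w k)⁻¹‖).congr fun α => ?_
    rw [shift k hw, norm_mul (chi w k)⁻¹]
    rfl
  have hlau {a : Idx D → ℂ} (k : Idx D) {w : Fin D → ℂ} (hw : ∀ i, w i ≠ 0) :
      laurent (fun α => a (α + k)) w = (chi w k)⁻¹ * laurent a w := by
    rw [laurent, laurent, ← (Equiv.addRight k).tsum_eq fun α => a α * chi w α, ← tsum_mul_left]
    exact tsum_congr fun α => shift k hw α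
  funext k
  set r : Fin D → ℝ := fun i => ‖z i‖ with hr
  have hr0 : ∀ i, r i ≠ 0 := fun i => norm_ne_zero_iff.2 (hz i)
  have hrz : ∀ i, ‖((r i : ℝ) : ℂ)‖ = ‖z i‖ := fun i => by simp [hr]
  have hc : ∀ i, (r i : ℂ) ≠ 0 := fun i => Complex.ofReal_ne_zero.2 (hr0 i)
  have ia := torusIntegral_laurent hr0 (habs k hc (ha.congr_norm hrz))
  have ib := torusIntegral_laurent hr0 (habs k hc (hb.congr_norm hrz))
  have hI : (2 * Real.pi * Complex.I) ^ D ≠ 0 := pow_ne_zero _ Complex.two_pi_I_ne_zero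
  have : torusIntegral (fun z => laurent (fun α => a (α + k)) z / ∏ i, z i) 0 r =
      torusIntegral (fun z => laurent (fun α => b (α + k)) z / ∏ i, z i) 0 r := by
    rw [torusIntegral, torusIntegral]
    congr 1
    funext θ
    have hn : ∀ i, ‖torusMap 0 r θ i‖ = ‖z i‖ := fun i => by
      simp [torusMap, hr, Complex.norm_exp_ofReal_mul_I]
    have hw : ∀ i, torusMap 0 r θ i ≠ 0 := fun i => by
      rw [← norm_ne_zero_iff, hn]; exact hr0 i
    rw [hlau k hw, hlau k hw, h _ hn]
  rw [ia, ib] at this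
  simpa using mul_left_cancel₀ hI this

end Laurent

end TorusLaurent

namespace TorusLaurent

/-! ### Semi-infinite matrices with finite rows -/

section Matrices

variable {D : ℕ}

/-- Every row of the matrix has finitely many nonzero entries. -/
def RowFinite (A : IMat D) : Prop := ∀ α, (Function.support (A α)).Finite

theorem finite_longitude_le (n : ℕ) : {β : Idx D | longitude β ≤ n}.Finite := by
  refine (Set.finite_Icc (fun _ => -(n : ℤ)) (fun _ => (n : ℤ))).subset fun β hβ => ?_
  have h (a : Fin D) : (β a).natAbs ≤ n :=
    (Finset.single_le_sum (f := fun a => (β a).natAbs) (fun _ _ => Nat.zero_le _)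
      (Finset.mem_univ a)).trans hβ
  constructor <;> intro a <;> have := h a <;> simp only <;> omega

theorem BlockUnitriangular.rowFinite {A : IMat D} (h : BlockUnitriangular A) : RowFinite A := by
  refine fun α => (finite_longitude_le (longitude α)).subset fun β hβ => ?_
  by_contra hlt
  exact hβ (h.1 α β (not_le.1 hlt))

theorem BlockDiagonal.rowFinite {A : IMat D} (h : BlockDiagonal A) : RowFinite A := by
  refine fun α => (finite_longitude_le (longitude α)).subset fun β hβ => ?_
  by_contra hlt
  exact hβ (h α β (not_le.1 hlt).ne)

theorem BlockDiagonal.conjTranspose {A : IMat D} (h : BlockDiagonal A) : BlockDiagonal Aᴴ :=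
  fun α β hαβ => by simp [Matrix.conjTranspose_apply, h β α hαβ.symm]

theorem RowFinite.mul {A B : IMat D} (hA : RowFinite A) (hB : RowFinite B) :
    RowFinite (A ⊠ B) := by
  intro α
  refine ((hA α).biUnion fun γ _ => hB γ).subset fun β hβ => ?_
  by_contra h
  simp only [Set.mem_iUnion, Function.mem_support, not_exists, not_not] at h
  refine hβ ?_
  rw [TorusLaurent.mulMat]
  refine (tsum_congr fun γ => ?_).trans tsum_zero
  by_cases hγ : A α γ = 0
  · simp [hγ]
  · simp [h γ hγ]

theorem conjTranspose_mulMat (A B : IMat D) : (A ⊠ B)ᴴ = Bᴴ ⊠ Aᴴ := by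
  ext α β
  simp only [Matrix.conjTranspose_apply, mulMat]
  rw [show ∀ x : ℂ, star x = starRingEnd ℂ x from fun _ => rfl, Complex.conj_tsum]
  refine tsum_congr fun γ => ?_
  simp [mul_comm]

theorem one_mulMat (A : IMat D) : 1 ⊠ A = A := by
  ext α β
  rw [mulMat, tsum_eq_single α fun γ hγ => by simp [Matrix.one_apply_ne hγ.symm]]
  simp

theorem mulMat_one (A : IMat D) : A ⊠ 1 = A := by
  ext α β
  rw [mulMat, tsum_eq_single β fun γ hγ => by simp [Matrix.one_apply_ne hγ]]
  simp

theorem RowFinite.apply_eq_zero {A : IMat D} (hA : RowFinite A) {α γ : Idx D}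
    (h : γ ∉ (hA α).toFinset) : A α γ = 0 := by
  by_contra h0
  exact h ((hA α).mem_toFinset.2 h0)

theorem RowFinite.mulMat_apply {A : IMat D} (hA : RowFinite A) (B : IMat D) (α β : Idx D) :
    (A ⊠ B) α β = ∑ γ ∈ (hA α).toFinset, A α γ * B γ β :=
  tsum_eq_sum fun γ hγ => by
    rw [hA.apply_eq_zero hγ, zero_mul]

theorem RowFinite.act_apply {A : IMat D} (hA : RowFinite A) (v : Idx D → ℂ) (α : Idx D) :
    act A v α = ∑ γ ∈ (hA α).toFinset, A α γ * v γ :=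
  tsum_eq_sum fun γ hγ => by
    rw [hA.apply_eq_zero hγ, zero_mul]

/-- Semi-infinite products are not associative in general. Finite rows on the left make the outer
sum finite, so only the inner sums need to converge. -/
theorem RowFinite.mulMat_assoc {A B C : IMat D} (hA : RowFinite A)
    (h : ∀ γ β, Summable fun δ => B γ δ * C δ β) : A ⊠ B ⊠ C = A ⊠ (B ⊠ C) := by
  ext α β
  rw [hA.mulMat_apply, mulMat]
  simp only [hA.mulMat_apply B, Finset.sum_mul]
  simp only [mulMat, ← tsum_mul_left]
  rw [Summable.tsum_finsetSum fun γ _ => ?_]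
  · simp only [mul_assoc]
  · simpa only [mul_assoc] using (h γ β).mul_left (A α γ)

theorem mulMat_assoc_of_rowFinite_conjTranspose {A B C : IMat D} (hC : RowFinite Cᴴ)
    (h : ∀ γ β, Summable fun δ => A γ δ * B δ β) : A ⊠ B ⊠ C = A ⊠ (B ⊠ C) := by
  apply Matrix.conjTranspose_injective
  simp only [conjTranspose_mulMat]
  refine (hC.mulMat_assoc fun γ β => ?_).symm
  have := (h β γ).star
  simpa [Matrix.conjTranspose_apply, mul_comm] using this

theorem RowFinite.summable_mul {A : IMat D} (hA : RowFinite A) (B : IMat D) (α β : Idx D) :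
    Summable fun γ => A α γ * B γ β :=
  summable_of_hasFiniteSupport ((hA α).subset fun γ hγ h0 => hγ (by simp [h0]))

theorem summable_mul_of_rowFinite_conjTranspose {B : IMat D} (A : IMat D) (hB : RowFinite Bᴴ)
    (α β : Idx D) : Summable fun γ => A α γ * B γ β :=
  summable_of_hasFiniteSupport ((hB β).subset fun γ hγ h0 => hγ (by
    have : B γ β = 0 := by simpa [Matrix.conjTranspose_apply] using h0
    simp [this]))

theorem RowFinite.actConverges {A : IMat D} (hA : RowFinite A) (z : Fin D → ℂ) :
    ActConverges A z := fun α => AbsConv.of_finite_support (hA α) z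

theorem RowFinite.actConverges_mulMat {A B : IMat D} {z : Fin D → ℂ} (hA : RowFinite A)
    (hB : ActConverges B z) : ActConverges (A ⊠ B) z := by
  intro α
  refine Summable.of_nonneg_of_le (fun _ => norm_nonneg _) (fun β => ?_)
    (summable_sum (s := (hA α).toFinset) fun γ _ => (hB γ).mul_left ‖A α γ‖)
  rw [hA.mulMat_apply, Finset.sum_mul]
  refine (norm_sum_le _ _).trans_eq (Finset.sum_congr rfl fun γ _ => ?_)
  rw [mul_assoc, norm_mul]

theorem RowFinite.act_mulMat {A B : IMat D} {z : Fin D → ℂ} (hA : RowFinite A)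
    (hB : ActConverges B z) : act (A ⊠ B) (chi z) = act A (act B (chi z)) := by
  ext α
  rw [hA.act_apply, act]
  simp only [hA.mulMat_apply, act, Finset.sum_mul, ← tsum_mul_left]
  rw [Summable.tsum_finsetSum fun γ _ => ?_]
  · simp only [mul_assoc]
  · simpa only [mul_assoc] using (hB γ).of_norm.mul_left (A α γ)

/-! ### Matrices which are constant along diagonals -/

/-- The matrix `∑_α a_α Υ_α`, with entries `a_{γ-β}`. -/
def toeplitz (a : Idx D → ℂ) : IMat D := fun β γ => a (γ - β)

theorem toeplitz_mulMat (a b : Idx D → ℂ) : toeplitz a ⊠ toeplitz b = toeplitz (conv a b) := by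
  ext α β
  simp only [mulMat, toeplitz, conv]
  rw [← (Equiv.subRight α).tsum_eq fun j => a j * b (β - α - j)]
  refine tsum_congr fun γ => ?_
  simp

theorem conjTranspose_toeplitz (a : Idx D → ℂ) :
    (toeplitz a)ᴴ = toeplitz fun α => star a (-α) := by
  ext α β
  simp [Matrix.conjTranspose_apply, toeplitz]

theorem toeplitz_term {z : Fin D → ℂ} (hz : ∀ i, z i ≠ 0) (a : Idx D → ℂ) (α β : Idx D) :
    toeplitz a α β * chi z β = chi z α * (a (β - α) * chi z (β - α)) := by
  have : chi z β = chi z α * chi z (β - α) := by rw [← chi_add hz, add_sub_cancel]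
  rw [this, toeplitz]; ring

theorem actConverges_toeplitz {z : Fin D → ℂ} (hz : ∀ i, z i ≠ 0) {a : Idx D → ℂ}
    (h : AbsConv a z) : ActConverges (toeplitz a) z := by
  intro α
  have := (Equiv.subRight α).summable_iff (f := fun β => ‖a β * chi z β‖) |>.2 h
  refine (this.mul_left ‖chi z α‖).congr fun β => ?_
  rw [toeplitz_term hz, norm_mul (chi z α)]
  rfl

/-- Because z^β = z^α z^(β-α), every row sum is z^α times the same Laurent series. -/
theorem act_toeplitz {z : Fin D → ℂ} (hz : ∀ i, z i ≠ 0) (a : Idx D → ℂ) :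
    act (toeplitz a) (chi z) = laurent a z • chi z := by
  ext α
  simp only [act, toeplitz_term hz, tsum_mul_left, Pi.smul_apply, smul_eq_mul]
  rw [mul_comm, laurent]
  congr 1
  exact (Equiv.subRight α).tsum_eq fun β => a β * chi z β

theorem RowFinite.actConverges_mulMat_toeplitz {A : IMat D} {z : Fin D → ℂ} {a : Idx D → ℂ}
    (hA : RowFinite A) (hz : ∀ i, z i ≠ 0) (h : AbsConv a z) :
    ActConverges (A ⊠ toeplitz a) z :=
  hA.actConverges_mulMat (actConverges_toeplitz hz h)

theorem RowFinite.act_mulMat_toeplitz {A : IMat D} {z : Fin D → ℂ} {a : Idx D → ℂ}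
    (hA : RowFinite A) (hz : ∀ i, z i ≠ 0) (h : AbsConv a z) (α : Idx D) :
    act (A ⊠ toeplitz a) (chi z) α = laurent a z * act A (chi z) α := by
  rw [hA.act_mulMat (actConverges_toeplitz hz h), act_toeplitz hz, hA.act_apply, hA.act_apply,
    Finset.mul_sum]
  refine Finset.sum_congr rfl fun γ _ => ?_
  simp only [Pi.smul_apply, smul_eq_mul]; ring

theorem actConverges_toeplitz_mulMat_conjTranspose {Q : IMat D} {z : Fin D → ℂ} {a : Idx D → ℂ}
    (hQ : RowFinite Qᴴ) (hz : ∀ i, z i ≠ 0) (h : AbsConv a z) :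
    ActConverges (toeplitz a ⊠ Q)ᴴ z⁻¹ := by
  rw [conjTranspose_mulMat, conjTranspose_toeplitz]
  exact hQ.actConverges_mulMat_toeplitz (fun i => inv_ne_zero (hz i)) (absConv_reflect h.star)

/-- Conjugate transposition conjugates and reflects the symbol. Evaluating at the inverse point
undoes the reflection, leaving the conjugate of the series at the conjugate point. -/
theorem act_toeplitz_mulMat_conjTranspose {Q : IMat D} {z : Fin D → ℂ} {a : Idx D → ℂ}
    (hQ : RowFinite Qᴴ) (hz : ∀ i, z i ≠ 0) (h : AbsConv a z) (α : Idx D) :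
    act (toeplitz a ⊠ Q)ᴴ (chi z⁻¹) α = star (laurent a (star z)) * act Qᴴ (chi z⁻¹) α := by
  rw [conjTranspose_mulMat, conjTranspose_toeplitz,
    hQ.act_mulMat_toeplitz (z := z⁻¹) (fun i => inv_ne_zero (hz i)) (absConv_reflect h.star),
    laurent_reflect, laurent_star]

/-! ### The vacuum wave matrix -/

/-- Convolution powers. -/
noncomputable def convPow (t : Idx D → ℂ) : ℕ → Idx D → ℂ
  | 0 => Pi.single 0 1
  | n + 1 => conv (convPow t n) t

/-- The coefficients of `exp (∑ t_α z^α)`. -/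
noncomputable def convExp (t : Idx D → ℂ) : Idx D → ℂ :=
  fun k => ∑' n : ℕ, (n.factorial : ℂ)⁻¹ * convPow t n k

theorem timeMatrix_eq_toeplitz (t : Idx D → ℂ) : timeMatrix t = toeplitz t := by
  ext β γ
  rw [timeMatrix, tsum_eq_single (γ - β)]
  · simp [upsilon, toeplitz]
  · intro α hα
    have : β + α ≠ γ := fun h => hα (by rw [← h, add_sub_cancel_left])
    simp [upsilon, this]

theorem toeplitz_single : toeplitz (Pi.single 0 1 : Idx D → ℂ) = 1 := by
  ext β γ
  simp [toeplitz, Pi.single_apply, Matrix.one_apply, sub_eq_zero, eq_comm]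

theorem powMat_toeplitz (t : Idx D → ℂ) (n : ℕ) :
    powMat (toeplitz t) n = toeplitz (convPow t n) := by
  induction n with
  | zero => rw [powMat, convPow, toeplitz_single]
  | succ n ih => rw [powMat, ih, toeplitz_mulMat, convPow]

theorem vacuum_eq_toeplitz (t : Idx D → ℂ) : vacuum t = toeplitz (convExp t) := by
  ext β γ
  simp only [vacuum, expMat, timeMatrix_eq_toeplitz, powMat_toeplitz]
  rfl

theorem absConv_single (z : Fin D → ℂ) : AbsConv (Pi.single 0 1 : Idx D → ℂ) z :=
  AbsConv.of_finite_support ((Set.finite_singleton 0).subset Pi.support_single_subset) z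

theorem laurent_single (z : Fin D → ℂ) : laurent (Pi.single 0 1 : Idx D → ℂ) z = 1 := by
  rw [laurent, tsum_eq_single 0 fun α hα => by simp [hα]]
  simp [chi_zero]

/-! ### Convergence and sum of the exponential series -/

section
variable {t : Idx D → ℂ} {z : Fin D → ℂ}

theorem absConv_convPow (hz : ∀ i, z i ≠ 0) (h : AbsConv t z) (n : ℕ) :
    AbsConv (convPow t n) z := by
  induction n with
  | zero => exact absConv_single z
  | succ n ih => exact ih.conv hz h

theorem laurent_convPow (hz : ∀ i, z i ≠ 0) (h : AbsConv t z) (n : ℕ) :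
    laurent (convPow t n) z = laurent t z ^ n := by
  induction n with
  | zero => rw [convPow, laurent_single, pow_zero]
  | succ n ih => rw [convPow, laurent_conv hz (absConv_convPow hz h n) h, ih, pow_succ]

theorem tsum_norm_convPow_le (hz : ∀ i, z i ≠ 0) (h : AbsConv t z) (n : ℕ) :
    ∑' k, ‖convPow t n k * chi z k‖ ≤ (∑' k, ‖t k * chi z k‖) ^ n := by
  induction n with
  | zero =>
    rw [tsum_eq_single 0 fun α hα => by simp [convPow, hα]]
    simp [convPow, chi_zero]
  | succ n ih =>
    refine (tsum_norm_conv_le hz (absConv_convPow hz h n) h).trans ?_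
    rw [pow_succ]
    exact mul_le_mul_of_nonneg_right ih (tsum_nonneg fun _ => norm_nonneg _)

/-- With M the weighted ℓ¹ norm of `t`, the n-th convolution power has norm at most Mⁿ, so the
double series is dominated by ∑ Mⁿ/n!. -/
theorem summable_norm_convExp_terms (hz : ∀ i, z i ≠ 0) (h : AbsConv t z) :
    Summable fun p : ℕ × Idx D =>
      ‖(p.1.factorial : ℂ)⁻¹ * convPow t p.1 p.2 * chi z p.2‖ := by
  rw [summable_prod_of_nonneg fun _ => norm_nonneg _]
  refine ⟨fun n => AbsConv.const_mul (absConv_convPow hz h n) (n.factorial : ℂ)⁻¹, ?_⟩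
  refine Summable.of_nonneg_of_le (fun _ => tsum_nonneg fun _ => norm_nonneg _) (fun n => ?_)
    (Real.summable_pow_div_factorial (∑' k, ‖t k * chi z k‖))
  have e (k : Idx D) : ‖(n.factorial : ℂ)⁻¹ * convPow t n k * chi z k‖ =
      (n.factorial : ℝ)⁻¹ * ‖convPow t n k * chi z k‖ := by
    rw [mul_assoc, norm_mul (_ : ℂ)⁻¹, norm_inv, Complex.norm_natCast]
  rw [tsum_congr e, tsum_mul_left, div_eq_inv_mul]
  exact mul_le_mul_of_nonneg_left (tsum_norm_convPow_le hz h n) (by positivity)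

theorem absConv_convExp (hz : ∀ i, z i ≠ 0) (h : AbsConv t z) : AbsConv (convExp t) z := by
  have hs := (summable_norm_convExp_terms hz h).prod_symm
  refine Summable.of_nonneg_of_le (fun _ => norm_nonneg _) (fun k => ?_) hs.prod
  rw [convExp, ← tsum_mul_right]
  exact norm_tsum_le_tsum_norm (hs.prod_factor k)

theorem laurent_convExp (hz : ∀ i, z i ≠ 0) (h : AbsConv t z) :
    laurent (convExp t) z = Complex.exp (laurent t z) := by
  have hs := (summable_norm_convExp_terms hz h).of_norm
  have e (k : Idx D) : convExp t k * chi z k =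
      ∑' n : ℕ, (n.factorial : ℂ)⁻¹ * convPow t n k * chi z k := tsum_mul_right.symm
  rw [laurent, tsum_congr e, Summable.tsum_comm (f := fun (n : ℕ) (k : Idx D) =>
    (n.factorial : ℂ)⁻¹ * convPow t n k * chi z k) hs, Complex.exp_eq_exp_ℂ,
    NormedSpace.exp_eq_tsum_div]
  refine tsum_congr fun n => ?_
  rw [div_eq_inv_mul, ← laurent_convPow hz h n]
  exact laurent_const_mul (convPow t n) z (n.factorial : ℂ)⁻¹

end

end Matrices

end TorusLaurent

namespace TorusLaurent

/-! ### The wave matrices as products of finite and constant-diagonal matrices -/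

section Wave

variable {D : ℕ}

/-- The symbol of the moment matrix. -/
noncomputable def momentSymbol (μ : ComplexMeasure (Fin D → Circle)) : Idx D → ℂ :=
  fun k => (((2 * Real.pi) ^ D : ℝ) : ℂ) * momentCoeff μ k

theorem momentMatrix_eq_toeplitz (μ : ComplexMeasure (Fin D → Circle)) :
    momentMatrix μ = toeplitz (momentSymbol μ) := by
  ext α β
  have h : (((2 * Real.pi) ^ D : ℝ) : ℂ) ≠ 0 :=
    Complex.ofReal_ne_zero.2 (pow_ne_zero _ Real.two_pi_pos.ne')
  rw [toeplitz, momentSymbol, momentCoeff, mul_inv_cancel_left₀ h]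
  simp [momentMatrix]

theorem deformedMoment_eq_toeplitz (μ : ComplexMeasure (Fin D → Circle)) (t : Idx D → ℂ) :
    deformedMoment μ t = toeplitz (conv (convExp t) (momentSymbol μ)) := by
  rw [deformedMoment, vacuum_eq_toeplitz, momentMatrix_eq_toeplitz, toeplitz_mulMat]

/-- A point of the algebraic torus at which the series of the time `t` and of the measure
converge absolutely. -/
structure ConvergencePoint (μ : ComplexMeasure (Fin D → Circle)) (t : Idx D → ℂ)
    (z : Fin D → ℂ) : Prop where
  ne_zero : ∀ i, z i ≠ 0
  time : AbsConv t z
  moment : AbsConv (momentCoeff μ) z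

variable {μ : ComplexMeasure (Fin D → Circle)} {t : Idx D → ℂ} {z : Fin D → ℂ}

theorem ConvergentTime.convergencePoint (ht : ConvergentTime μ t) (hz : z ∈ reinhardtDomain μ) :
    ConvergencePoint μ t z :=
  ⟨(interior_subset hz).1, ht.domain z hz, (interior_subset hz).2⟩

namespace ConvergencePoint

theorem congr_norm {w : Fin D → ℂ} (h : ConvergencePoint μ t z) (hw : ∀ i, ‖w i‖ = ‖z i‖) :
    ConvergencePoint μ t w :=
  ⟨fun i => norm_ne_zero_iff.1 (by rw [hw]; exact norm_ne_zero_iff.2 (h.ne_zero i)),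
    h.time.congr_norm hw, h.moment.congr_norm hw⟩

theorem star (h : ConvergencePoint μ t z) : ConvergencePoint μ t (star z) :=
  h.congr_norm fun i => by simp

theorem symbol (h : ConvergencePoint μ t z) : AbsConv (momentSymbol μ) z :=
  h.moment.const_mul _

theorem exp (h : ConvergencePoint μ t z) : AbsConv (convExp t) z :=
  absConv_convExp h.ne_zero h.time

theorem exp_neg (h : ConvergencePoint μ t z) : AbsConv (convExp (-t)) z :=
  absConv_convExp h.ne_zero h.time.neg

theorem laurent_exp (h : ConvergencePoint μ t z) :
    laurent (convExp t) z = Complex.exp (laurent t z) :=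
  laurent_convExp h.ne_zero h.time

theorem laurent_exp_neg (h : ConvergencePoint μ t z) :
    laurent (convExp (-t)) z = (Complex.exp (laurent t z))⁻¹ := by
  rw [laurent_convExp h.ne_zero h.time.neg, laurent_neg, Complex.exp_neg]

theorem deformed (h : ConvergencePoint μ t z) :
    AbsConv (conv (convExp t) (momentSymbol μ)) z :=
  h.exp.conv h.ne_zero h.symbol

theorem laurent_deformed (h : ConvergencePoint μ t z) :
    laurent (conv (convExp t) (momentSymbol μ)) z =
      Complex.exp (laurent t z) * laurent (momentSymbol μ) z := by
  rw [laurent_conv h.ne_zero h.exp h.symbol, h.laurent_exp]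

/-- The identity e^{-t} e^{t} μ̂ = μ̂ is checked for the sums on the torus through `z`; uniqueness
of Laurent coefficients transfers it to the convolutions, with no rearrangement of triple series. -/
theorem conv_exp_neg_deformed (h : ConvergencePoint μ t z) :
    conv (convExp (-t)) (conv (convExp t) (momentSymbol μ)) = momentSymbol μ := by
  refine eq_of_laurent_eq h.ne_zero (h.exp_neg.conv h.ne_zero h.deformed) h.symbol fun w hw => ?_
  have h' := h.congr_norm hw
  rw [laurent_conv h'.ne_zero h'.exp_neg h'.deformed, h'.laurent_deformed, h'.laurent_exp_neg,
    inv_mul_cancel_left₀ (Complex.exp_ne_zero _)]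

theorem conv_deformed_exp_neg (h : ConvergencePoint μ t z) :
    conv (conv (convExp t) (momentSymbol μ)) (convExp (-t)) = momentSymbol μ := by
  refine eq_of_laurent_eq h.ne_zero (h.deformed.conv h.ne_zero h.exp_neg) h.symbol fun w hw => ?_
  have h' := h.congr_norm hw
  rw [laurent_conv h'.ne_zero h'.deformed h'.exp_neg, h'.laurent_deformed, h'.laurent_exp_neg,
    mul_comm, inv_mul_cancel_left₀ (Complex.exp_ne_zero _)]

end ConvergencePoint

theorem summable_toeplitz_mul {a b : Idx D → ℂ} (hz : ∀ i, z i ≠ 0) (ha : AbsConv a z)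
    (hb : AbsConv b z) (α β : Idx D) : Summable fun γ => toeplitz a α γ * toeplitz b γ β := by
  have := (Equiv.subRight α).summable_iff (f := fun j => a j * b (β - α - j)) |>.2
    (summable_norm_conv hz ha hb (β - α)).of_norm
  simpa [toeplitz, Function.comp_def] using this

namespace GaussBorel

/-! ### Consequences of the Gauss–Borel factorization -/

section
variable {G : IMat D} (F : GaussBorel G)

theorem rowFinite_S : RowFinite F.S := F.S_tri.rowFinite

theorem rowFinite_SHat : RowFinite F.SHat := F.SHat_tri.rowFinite

theorem rowFinite_conjTranspose_conjTranspose_SHat : RowFinite F.SHatᴴᴴ := by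
  rw [Matrix.conjTranspose_conjTranspose]; exact F.rowFinite_SHat

theorem rowFinite_HInv_mul_S : RowFinite (F.HInv ⊠ F.S) :=
  F.HInv_diag.rowFinite.mul F.rowFinite_S

theorem rowFinite_conjTranspose_SHat_mul_HInv : RowFinite (F.SHatᴴ ⊠ F.HInv)ᴴ := by
  rw [conjTranspose_mulMat, Matrix.conjTranspose_conjTranspose]
  exact F.HInv_diag.conjTranspose.rowFinite.mul F.rowFinite_SHat

/-- Multiply the factorization on the right by Ŝ†, whose columns are finite. The extra matrix `T`
lets G be replaced by its diagonal-constant form without changing the type of `F`. -/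
theorem SInv_mul_H {T : IMat D} (hT : T = G) : F.SInv ⊠ F.H = T ⊠ F.SHatᴴ := by
  have h : F.SHatInvᴴ ⊠ F.SHatᴴ = 1 := by
    rw [← conjTranspose_mulMat, F.SHat_mul_SHatInv, Matrix.conjTranspose_one]
  rw [hT.trans F.factorization,
    mulMat_assoc_of_rowFinite_conjTranspose F.rowFinite_conjTranspose_conjTranspose_SHat
    (summable_mul_of_rowFinite_conjTranspose _ ?_), h, mulMat_one]
  rw [Matrix.conjTranspose_conjTranspose]
  exact F.SHatInv_tri.rowFinite

theorem H_mul_SHatInv {T : IMat D} (hT : T = G) : F.H ⊠ F.SHatInvᴴ = F.S ⊠ T := by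
  rw [hT.trans F.factorization,
    F.SInv_tri.rowFinite.mulMat_assoc (F.H_diag.rowFinite.summable_mul _),
    ← F.rowFinite_S.mulMat_assoc (F.SInv_tri.rowFinite.summable_mul _), F.S_mul_SInv, one_mulMat]

/-- Trades S⁻¹, which has finite rows, for G times a matrix with finite columns. That is the form
needed when W₀(-t) multiplies from the left. -/
theorem SInv_eq {T : IMat D} (hT : T = G) : F.SInv = T ⊠ (F.SHatᴴ ⊠ F.HInv) := by
  rw [← mulMat_assoc_of_rowFinite_conjTranspose F.HInv_diag.conjTranspose.rowFinite
    (summable_mul_of_rowFinite_conjTranspose _ F.rowFinite_conjTranspose_conjTranspose_SHat),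
    ← F.SInv_mul_H hT, F.SInv_tri.rowFinite.mulMat_assoc (F.H_diag.rowFinite.summable_mul _),
    F.H_mul_HInv, mulMat_one]

theorem conjTranspose_SHatInv_eq {T : IMat D} (hT : T = G) :
    F.SHatInvᴴ = F.HInv ⊠ F.S ⊠ T := by
  rw [F.HInv_diag.rowFinite.mulMat_assoc (F.rowFinite_S.summable_mul _), ← F.H_mul_SHatInv hT,
    ← F.HInv_diag.rowFinite.mulMat_assoc (F.H_diag.rowFinite.summable_mul _), F.HInv_mul_H,
    one_mulMat]

end

/-! ### Wave matrices with their diagonal-constant factor isolated -/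

variable (F : GaussBorel (deformedMoment μ t))

theorem W1_eq : F.W1 = F.S ⊠ toeplitz (convExp t) := by
  rw [W1, vacuum_eq_toeplitz]

/-- Once S⁻¹ is written through G(t), the factor W₀(-t) meets W₀(t) G and only G survives. The point
`z` merely witnesses the convergence that justifies this. -/
theorem W1Inv_eq (h : ConvergencePoint μ t z) :
    F.W1Inv = toeplitz (momentSymbol μ) ⊠ (F.SHatᴴ ⊠ F.HInv) := by
  rw [W1Inv, F.SInv_eq (deformedMoment_eq_toeplitz μ t).symm, vacuum_eq_toeplitz,
    ← mulMat_assoc_of_rowFinite_conjTranspose F.rowFinite_conjTranspose_SHat_mul_HInv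
      (summable_toeplitz_mul h.ne_zero h.exp_neg h.deformed),
    toeplitz_mulMat, h.conv_exp_neg_deformed]

theorem W1Hat_eq : F.W1Hat = (toeplitz (convExp t) ⊠ F.SHatᴴ)ᴴ := by
  rw [W1Hat, vacuum_eq_toeplitz]

theorem W1HatInv_eq (h : ConvergencePoint μ t z) :
    F.W1HatInvᴴ = F.HInv ⊠ F.S ⊠ toeplitz (momentSymbol μ) := by
  rw [W1HatInv, Matrix.conjTranspose_conjTranspose,
    F.conjTranspose_SHatInv_eq (deformedMoment_eq_toeplitz μ t).symm, vacuum_eq_toeplitz,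
    F.rowFinite_HInv_mul_S.mulMat_assoc (summable_toeplitz_mul h.ne_zero h.deformed h.exp_neg),
    toeplitz_mulMat, h.conv_deformed_exp_neg]

theorem W2_eq : F.W2 = (toeplitz (conv (convExp t) (momentSymbol μ)) ⊠ F.SHatᴴ)ᴴ := by
  rw [W2, F.SInv_mul_H (deformedMoment_eq_toeplitz μ t).symm]

theorem W2Hat_eq : F.W2Hat = F.S ⊠ toeplitz (conv (convExp t) (momentSymbol μ)) := by
  rw [W2Hat, F.H_mul_SHatInv (deformedMoment_eq_toeplitz μ t).symm]

theorem bakerConverges (ht : ConvergentTime μ t) : F.BakerConverges := by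
  refine ⟨fun z hz => ?_, fun z => ⟨?_, ?_⟩⟩
  · have h := ht.convergencePoint hz
    rw [W1_eq, F.W1Inv_eq h, W1Hat_eq, F.W1HatInv_eq h, W2Hat_eq, W2_eq]
    exact ⟨F.rowFinite_S.actConverges_mulMat_toeplitz h.ne_zero h.exp,
      actConverges_toeplitz_mulMat_conjTranspose F.rowFinite_conjTranspose_SHat_mul_HInv
        h.ne_zero h.symbol,
      actConverges_toeplitz_mulMat_conjTranspose F.rowFinite_conjTranspose_conjTranspose_SHat
        h.ne_zero h.exp,
      F.rowFinite_HInv_mul_S.actConverges_mulMat_toeplitz h.ne_zero h.symbol,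
      F.rowFinite_S.actConverges_mulMat_toeplitz h.ne_zero h.deformed,
      actConverges_toeplitz_mulMat_conjTranspose F.rowFinite_conjTranspose_conjTranspose_SHat
        h.ne_zero h.deformed⟩
  · exact F.rowFinite_conjTranspose_SHat_mul_HInv.actConverges z
  · rw [W2Inv, Matrix.conjTranspose_conjTranspose]
    exact F.rowFinite_HInv_mul_S.actConverges z

/-! ### Closed forms of the Baker functions -/

theorem Psi1_apply (h : ConvergencePoint μ t z) (α : Idx D) :
    F.Psi1 z α = Complex.exp (laurent t z) * act F.S (chi z) α := by
  rw [Psi1, W1_eq, F.rowFinite_S.act_mulMat_toeplitz h.ne_zero h.exp, h.laurent_exp]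

theorem Psi1Adj_apply (h : ConvergencePoint μ t z) (α : Idx D) :
    F.Psi1Adj z⁻¹ α =
      star (laurent (momentSymbol μ) (star z)) * act (F.SHatᴴ ⊠ F.HInv)ᴴ (chi z⁻¹) α := by
  rw [Psi1Adj, F.W1Inv_eq h, act_toeplitz_mulMat_conjTranspose
    F.rowFinite_conjTranspose_SHat_mul_HInv h.ne_zero h.symbol]

theorem Psi1Hat_apply (h : ConvergencePoint μ t z) (α : Idx D) :
    F.Psi1Hat z⁻¹ α = star (Complex.exp (laurent t (star z))) * act F.SHat (chi z⁻¹) α := by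
  rw [Psi1Hat, W1Hat_eq, act_toeplitz_mulMat_conjTranspose
    F.rowFinite_conjTranspose_conjTranspose_SHat h.ne_zero h.exp, h.star.laurent_exp,
    Matrix.conjTranspose_conjTranspose]

theorem Psi1HatAdj_apply (h : ConvergencePoint μ t z) (α : Idx D) :
    F.Psi1HatAdj z α = laurent (momentSymbol μ) z * act (F.HInv ⊠ F.S) (chi z) α := by
  rw [Psi1HatAdj, F.W1HatInv_eq h,
    F.rowFinite_HInv_mul_S.act_mulMat_toeplitz h.ne_zero h.symbol]

theorem Psi2_apply (h : ConvergencePoint μ t z) (α : Idx D) :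
    F.Psi2 z⁻¹ α = star (Complex.exp (laurent t (star z)) *
      laurent (momentSymbol μ) (star z)) * act F.SHat (chi z⁻¹) α := by
  rw [Psi2, W2_eq, act_toeplitz_mulMat_conjTranspose
    F.rowFinite_conjTranspose_conjTranspose_SHat h.ne_zero h.deformed, h.star.laurent_deformed,
    Matrix.conjTranspose_conjTranspose]

theorem Psi2Hat_apply (h : ConvergencePoint μ t z) (α : Idx D) :
    F.Psi2Hat z α = Complex.exp (laurent t z) * laurent (momentSymbol μ) z *
      act F.S (chi z) α := by
  rw [Psi2Hat, W2Hat_eq, F.rowFinite_S.act_mulMat_toeplitz h.ne_zero h.deformed,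
    h.laurent_deformed]

theorem Psi2Adj_eq (z : Fin D → ℂ) : F.Psi2Adj z = act (F.HInv ⊠ F.S) (chi z) := by
  rw [Psi2Adj, W2Inv, Matrix.conjTranspose_conjTranspose]

theorem Psi2HatAdj_eq (z : Fin D → ℂ) :
    F.Psi2HatAdj z = act (F.SHatᴴ ⊠ F.HInv)ᴴ (chi z) := rfl

end GaussBorel

end Wave

/-! ### Comparison of contour integrals -/

section Contour

variable {D : ℕ}

/-- On the set `K`, the function `f` is the sum of one absolutely convergent Laurent series. -/
def LaurentOn (K : Set (Fin D → ℂ)) (f : (Fin D → ℂ) → ℂ) : Prop :=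
  ∃ a, ∀ w ∈ K, AbsConv a w ∧ laurent a w = f w

namespace LaurentOn

variable {K : Set (Fin D → ℂ)}

theorem of_absConv {a : Idx D → ℂ} (h : ∀ w ∈ K, AbsConv a w) : LaurentOn K (laurent a) :=
  ⟨a, fun w hw => ⟨h w hw, rfl⟩⟩

theorem congr {f g : (Fin D → ℂ) → ℂ} (hf : LaurentOn K f) (h : ∀ w ∈ K, g w = f w) :
    LaurentOn K g := by
  obtain ⟨a, ha⟩ := hf
  exact ⟨a, fun w hw => ⟨(ha w hw).1, (ha w hw).2.trans (h w hw).symm⟩⟩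

theorem mul (hK : ∀ w ∈ K, ∀ i, w i ≠ 0) {f g : (Fin D → ℂ) → ℂ} (hf : LaurentOn K f)
    (hg : LaurentOn K g) : LaurentOn K fun w => f w * g w := by
  obtain ⟨a, ha⟩ := hf
  obtain ⟨b, hb⟩ := hg
  refine ⟨conv a b, fun w hw => ⟨(ha w hw).1.conv (hK w hw) (hb w hw).1, ?_⟩⟩
  rw [laurent_conv (hK w hw) (ha w hw).1 (hb w hw).1, (ha w hw).2, (hb w hw).2]

theorem exp (hK : ∀ w ∈ K, ∀ i, w i ≠ 0) {a : Idx D → ℂ} (h : ∀ w ∈ K, AbsConv a w) :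
    LaurentOn K fun w => Complex.exp (laurent a w) :=
  ⟨convExp a, fun w hw => ⟨absConv_convExp (hK w hw) (h w hw), laurent_convExp (hK w hw) (h w hw)⟩⟩

/-- Conjugating both the value and the variable conjugates the coefficients. Hence the daggered
factors, evaluated at conjugated points, are again Laurent series in w itself. -/
theorem star_comp_star (hK : ∀ w ∈ K, star w ∈ K) {f : (Fin D → ℂ) → ℂ} (hf : LaurentOn K f) :
    LaurentOn K fun w => star (f (star w)) := by
  obtain ⟨a, ha⟩ := hf
  exact ⟨star a, fun w hw => ⟨(ha w hw).1.star, by rw [laurent_star, (ha _ (hK w hw)).2]⟩⟩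

theorem act {R : IMat D} (hR : RowFinite R) (α : Idx D) :
    LaurentOn K fun w => act R (chi w) α :=
  of_absConv fun w _ => AbsConv.of_finite_support (hR α) w

theorem act_inv {R : IMat D} (hR : RowFinite R) (α : Idx D) :
    LaurentOn K fun w => TorusLaurent.act R (chi w⁻¹) α := by
  refine ⟨fun β => R α (-β), fun w _ => ⟨?_, ?_⟩⟩
  · have := absConv_reflect (AbsConv.of_finite_support (hR α) w⁻¹)
    rwa [inv_inv] at this
  · have := laurent_reflect (R α) w⁻¹
    rwa [inv_inv] at this

theorem star_act {R : IMat D} (hR : RowFinite R) (α : Idx D) :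
    LaurentOn K fun w => star (TorusLaurent.act R (chi (star w)) α) :=
  ⟨star (R α), fun w _ => ⟨(AbsConv.of_finite_support (hR α) w).star, laurent_star _ w⟩⟩

theorem star_act_inv {R : IMat D} (hR : RowFinite R) (α : Idx D) :
    LaurentOn K fun w => star (TorusLaurent.act R (chi (star w)⁻¹) α) := by
  obtain ⟨a, ha⟩ := act_inv (K := Set.univ) hR α
  exact ⟨star a, fun w _ => ⟨(ha w trivial).1.star, by rw [laurent_star, (ha _ trivial).2]⟩⟩

end LaurentOn

theorem star_inv_fun (w : Fin D → ℂ) : star w⁻¹ = (star w)⁻¹ := by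
  ext i; simp

/-- The points whose poly-radius is that of `c` or that of `c'`. -/
def polyCircles (c c' : Fin D → ℂ) : Set (Fin D → ℂ) :=
  {w | (∀ i, ‖w i‖ = ‖c i‖) ∨ ∀ i, ‖w i‖ = ‖c' i‖}

theorem torusIntegral_congr_torusMap {f g : (Fin D → ℂ) → ℂ} {r : Fin D → ℝ}
    (h : ∀ θ, f (torusMap 0 r θ) = g (torusMap 0 r θ)) :
    (TorusIntegrable f 0 r ↔ TorusIntegrable g 0 r) ∧
      torusIntegral f 0 r = torusIntegral g 0 r := by
  simp only [TorusIntegrable, torusIntegral, h, and_self]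

/-- A single coefficient family represents the integrand on both tori, and the reflected family
represents `B` on the inverted one. Both integrals therefore equal (2πi)^D times the same constant
coefficient. -/
theorem contourEq_of_laurentOn {c c' : Fin D → ℂ} (hc : ∀ i, c i ≠ 0) (hc' : ∀ i, c' i ≠ 0)
    {A B : (Fin D → ℂ) → IMat D}
    (hA : ∀ α β, LaurentOn (polyCircles c c') fun w => A w α β)
    (hAB : ∀ w ∈ polyCircles c c', ∀ α β, B w⁻¹ α β = A w α β) :
    ContourEq (fun i => ‖c i‖) A (fun i => ‖c' i‖⁻¹) B := by
  have hr : ∀ i, ‖c i‖ ≠ 0 := fun i => norm_ne_zero_iff.2 (hc i)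
  have hs : ∀ i, ‖c' i‖⁻¹ ≠ 0 := fun i => inv_ne_zero (norm_ne_zero_iff.2 (hc' i))
  have key (α β : Idx D) : TorusIntegrable (fun z => A z α β / ∏ a, z a) 0 (fun i => ‖c i‖) ∧
      TorusIntegrable (fun z => B z α β / ∏ a, z a) 0 (fun i => ‖c' i‖⁻¹) ∧
      torusIntegral (fun z => A z α β / ∏ a, z a) 0 (fun i => ‖c i‖) =
        torusIntegral (fun z => B z α β / ∏ a, z a) 0 (fun i => ‖c' i‖⁻¹) := by
    obtain ⟨a, ha⟩ := hA α β
    have ha1 : AbsConv a fun i => ((‖c i‖ : ℝ) : ℂ) :=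
      (ha _ (Or.inl fun i => by simp)).1
    have ha2 : AbsConv (fun k => a (-k)) fun i => ((‖c' i‖⁻¹ : ℝ) : ℂ) :=
      (absConv_reflect (ha c' (Or.inr fun _ => rfl)).1).congr_norm fun i => by simp
    have e1 := torusIntegral_congr_torusMap (f := fun z => A z α β / ∏ a, z a)
      (g := fun z => laurent a z / ∏ i, z i) (r := fun i => ‖c i‖) fun θ => by
        rw [(ha _ (Or.inl fun i => by simp [torusMap, Complex.norm_exp_ofReal_mul_I])).2]
    have e2 := torusIntegral_congr_torusMap (f := fun z => B z α β / ∏ a, z a)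
      (g := fun z => laurent (fun k => a (-k)) z / ∏ i, z i) (r := fun i => ‖c' i‖⁻¹)
      fun θ => by
        -- The hypothesis `hAB` is used at the inverse of the contour point, which lies on the torus
        -- through c'.
        have hm : (torusMap 0 (fun i => ‖c' i‖⁻¹) θ)⁻¹ ∈ polyCircles c c' :=
          Or.inr fun i => by simp [torusMap, Complex.norm_exp_ofReal_mul_I]
        have h1 := hAB _ hm α β
        have h2 := laurent_reflect a (torusMap 0 (fun i => ‖c' i‖⁻¹) θ)⁻¹
        rw [inv_inv] at h1 h2
        rw [h1, h2, (ha _ hm).2]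
    rw [e1.1, e1.2, e2.1, e2.2, torusIntegral_laurent hr ha1, torusIntegral_laurent hs ha2,
      neg_zero]
    exact ⟨torusIntegrable_laurent hr ha1, torusIntegrable_laurent hs ha2, rfl⟩
  exact ⟨fun α β => (key α β).1, fun α β => (key α β).2.1, by ext α β; exact (key α β).2.2⟩

end Contour

end TorusLaurent

/-! ### The bilinear equations -/

theorem mainTheorem11 {D : ℕ} (μ : ComplexMeasure (Fin D → Circle))
    (c c' : Fin D → ℂ) (hc : c ∈ reinhardtDomain μ) (hc' : c' ∈ reinhardtDomain μ)
    (t t' : Idx D → ℂ) (ht : ConvergentTime μ t) (ht' : ConvergentTime μ t')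
    (F : GaussBorel (deformedMoment μ t)) (F' : GaussBorel (deformedMoment μ t'))
    (r s : Fin D → ℝ) (hr : r = fun a => ‖c a‖) (hs : s = fun a => ‖c' a‖⁻¹) :
    -- convergence of the series that define the Baker functions
    (F.BakerConverges ∧ F'.BakerConverges) ∧
    -- bilinear equations for the Baker functions
    ContourEq r (fun z => outer (F.Psi1 z) (F'.Psi1Adj (star z)⁻¹))
      s (fun z => outer (F.Psi2Hat z⁻¹) (F'.Psi2HatAdj (star z))) ∧
    ContourEq r (fun z => outer (F.Psi2 z⁻¹) (F'.Psi2Adj (star z)))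
      s (fun z => outer (F.Psi1Hat z) (F'.Psi1HatAdj (star z)⁻¹)) ∧
    ContourEq r (fun z => outer (F.Psi1 z) (F'.Psi2 (star z)⁻¹))
      s (fun z => outer (F.Psi2Hat z⁻¹) (F'.Psi1Hat (star z))) ∧
    ContourEq r (fun z => outer (F.Psi2Adj z) (F'.Psi1Adj (star z)⁻¹))
      s (fun z => outer (F.Psi1HatAdj z⁻¹) (F'.Psi2HatAdj (star z))) ∧
    -- bilinear equations for the orthogonal Laurent polynomials
    ContourEq
      r (fun z => (Complex.exp (laurent t z) * laurent (momentCoeff μ) z) •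
        outer (F.Phi z) (F'.PhiHat (star z)⁻¹))
      s (fun z => (Complex.exp (laurent t z⁻¹) * laurent (momentCoeff μ) z⁻¹) •
        outer (F.Phi z⁻¹) (F'.PhiHat (star z))) ∧
    ContourEq
      r (fun z => (Complex.exp (laurent (star t) z) * laurent (star (momentCoeff μ)) z) •
        outer (F.PhiHat z⁻¹) (F'.Phi (star z)))
      s (fun z => (Complex.exp (laurent (star t) z⁻¹) * laurent (star (momentCoeff μ)) z⁻¹) •
        outer (F.PhiHat z) (F'.Phi (star z)⁻¹)) ∧
    ContourEq
      r (fun z => (Complex.exp (laurent (t + t') z) * laurent (momentCoeff μ) z) •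
        outer (F.Phi z) (F'.PhiHat (star z)⁻¹))
      s (fun z => (Complex.exp (laurent (t + t') z⁻¹) * laurent (momentCoeff μ) z⁻¹) •
        outer (F.Phi z⁻¹) (F'.PhiHat (star z))) ∧
    ContourEq
      r (fun z => laurent (momentCoeff μ) z • outer (F.Phi z) (F'.PhiHat (star z)⁻¹))
      s (fun z => laurent (momentCoeff μ) z⁻¹ • outer (F.Phi z⁻¹) (F'.PhiHat (star z))) := by
  subst hr hs
  have hc0 : ∀ i, c i ≠ 0 := (interior_subset hc).1
  have hc0' : ∀ i, c' i ≠ 0 := (interior_subset hc').1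
  have hP {u : Idx D → ℂ} (hu : ConvergentTime μ u) :
      ∀ w ∈ polyCircles c c', ConvergencePoint μ u w := by
    rintro w (h | h)
    · exact (hu.convergencePoint hc).congr_norm h
    · exact (hu.convergencePoint hc').congr_norm h
  have hK : ∀ w ∈ polyCircles c c', ∀ i, w i ≠ 0 := fun w hw => (hP ht w hw).ne_zero
  have hKs : ∀ w ∈ polyCircles c c', star w ∈ polyCircles c c' := fun w hw => by
    simpa [polyCircles] using hw
  have hE {u : Idx D → ℂ} (hu : ∀ w ∈ polyCircles c c', AbsConv u w) :
      LaurentOn (polyCircles c c') fun w => Complex.exp (laurent u w) := LaurentOn.exp hK hu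
  have hM : LaurentOn (polyCircles c c') (laurent (momentCoeff μ)) :=
    LaurentOn.of_absConv fun w hw => (hP ht w hw).moment
  have hG : LaurentOn (polyCircles c c') (laurent (momentSymbol μ)) :=
    LaurentOn.of_absConv fun w hw => (hP ht w hw).symbol
  have het := hE fun w hw => (hP ht w hw).time
  have het' := hE fun w hw => (hP ht' w hw).time
  have hsum := hE fun w hw => (hP ht w hw).time.add (hP ht' w hw).time
  refine ⟨⟨F.bakerConverges ht, F'.bakerConverges ht'⟩, ?_, ?_, ?_, ?_, ?_, ?_, ?_, ?_⟩
  · refine contourEq_of_laurentOn hc0 hc0' (fun α β => ?_) fun w hw α β => ?_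
    · refine ((het.mul hK (LaurentOn.act F.rowFinite_S α)).mul hK (hG.mul hK
        (LaurentOn.star_act_inv F'.rowFinite_conjTranspose_SHat_mul_HInv β))).congr fun w hw => ?_
      simp [outer, Matrix.vecMulVec_apply, F.Psi1_apply (hP ht w hw),
        F'.Psi1Adj_apply (hP ht' w hw).star]
    -- Both sides are the same product: the symbol of the measure comes from the adjoint factor at
    -- t' on the left and from the Baker factor at t on the right. The third and fourth equations
    -- move it in the same way.
    · simp [outer, Matrix.vecMulVec_apply, F.Psi1_apply (hP ht w hw),
        F'.Psi1Adj_apply (hP ht' w hw).star, F.Psi2Hat_apply (hP ht w hw),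
        GaussBorel.Psi2HatAdj_eq, star_inv_fun]
      ring
  · refine contourEq_of_laurentOn hc0 hc0' (fun α β => ?_) fun w hw α β => ?_
    · refine ((((het.mul hK hG).star_comp_star hKs).mul hK
        (LaurentOn.act_inv F.rowFinite_SHat α)).mul hK
        (LaurentOn.star_act F'.rowFinite_HInv_mul_S β)).congr fun w hw => ?_
      simp [outer, Matrix.vecMulVec_apply, F.Psi2_apply (hP ht w hw), GaussBorel.Psi2Adj_eq]
    -- Here the conjugated symbol moves the other way, from the factor at t to the factor at t'.
    · simp [outer, Matrix.vecMulVec_apply, F.Psi2_apply (hP ht w hw), GaussBorel.Psi2Adj_eq,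
        F.Psi1Hat_apply (hP ht w hw), F'.Psi1HatAdj_apply (hP ht' w hw).star, star_inv_fun]
      ring
  · refine contourEq_of_laurentOn hc0 hc0' (fun α β => ?_) fun w hw α β => ?_
    · refine ((het.mul hK (LaurentOn.act F.rowFinite_S α)).mul hK ((het'.mul hK hG).mul hK
        (LaurentOn.star_act_inv F'.rowFinite_SHat β))).congr fun w hw => ?_
      simp [outer, Matrix.vecMulVec_apply, F.Psi1_apply (hP ht w hw),
        F'.Psi2_apply (hP ht' w hw).star]
    · simp [outer, Matrix.vecMulVec_apply, F.Psi1_apply (hP ht w hw),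
        F'.Psi2_apply (hP ht' w hw).star, F.Psi2Hat_apply (hP ht w hw),
        F'.Psi1Hat_apply (hP ht' w hw).star, star_inv_fun]
      ring
  · refine contourEq_of_laurentOn hc0 hc0' (fun α β => ?_) fun w hw α β => ?_
    · refine ((LaurentOn.act F.rowFinite_HInv_mul_S α).mul hK (hG.mul hK
        (LaurentOn.star_act_inv F'.rowFinite_conjTranspose_SHat_mul_HInv β))).congr fun w hw => ?_
      simp [outer, Matrix.vecMulVec_apply, GaussBorel.Psi2Adj_eq,
        F'.Psi1Adj_apply (hP ht' w hw).star]
    · simp [outer, Matrix.vecMulVec_apply, GaussBorel.Psi2Adj_eq,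
        F'.Psi1Adj_apply (hP ht' w hw).star, F.Psi1HatAdj_apply (hP ht w hw),
        GaussBorel.Psi2HatAdj_eq, star_inv_fun]
      ring
  · refine contourEq_of_laurentOn hc0 hc0' (fun α β => ?_) fun w hw α β => ?_
    -- In the polynomial equations the second integrand is, up to the harmless denominator, the
    -- first one at z⁻¹, so only the Laurent expansion of the weight on both tori matters.
    · exact (het.mul hK hM).mul hK ((LaurentOn.act F.rowFinite_S α).mul hK
        (LaurentOn.star_act_inv F'.rowFinite_SHat β))
    · simp only [inv_inv, star_inv_fun]
  · refine contourEq_of_laurentOn hc0 hc0' (fun α β => ?_) fun w hw α β => ?_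
    · exact ((hE fun w hw => (hP ht w hw).time.star).mul hK
        (LaurentOn.of_absConv fun w hw => (hP ht w hw).moment.star)).mul hK
        ((LaurentOn.act_inv F.rowFinite_SHat α).mul hK
          (LaurentOn.star_act F'.rowFinite_S β))
    · simp only [inv_inv, star_inv_fun]
  · refine contourEq_of_laurentOn hc0 hc0' (fun α β => ?_) fun w hw α β => ?_
    · exact (hsum.mul hK hM).mul hK ((LaurentOn.act F.rowFinite_S α).mul hK
        (LaurentOn.star_act_inv F'.rowFinite_SHat β))
    · simp only [inv_inv, star_inv_fun]
  · refine contourEq_of_laurentOn hc0 hc0' (fun α β => ?_) fun w hw α β => ?_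
    · exact hM.mul hK ((LaurentOn.act F.rowFinite_S α).mul hK
        (LaurentOn.star_act_inv F'.rowFinite_SHat β))
    · simp only [inv_inv, star_inv_fun]
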